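/- Let $\log\Gamma$ denote the holomorphic branch of the logarithm of the Gamma function on $\mathbb{C}\setminus(-\infty,0]$ with $\log\Gamma(1)=0$, let $\log z$ be the principal logarithm, and let $$\mu(z)=\log\Gamma(z)-\left(z-\tfrac12\right)\log z+z-\tfrac12\log(2\pi)$$ be Binet's function. For integers $m\ge 1$ let $$b_m(\alpha)=\frac1m\sum_{k=1}^{m}\left\{\frac{\alpha^{k+2}-(\alpha-1)^{k+2}}{k+2}+\frac{\left(\frac12-\alpha\right)\left(\alpha^{k+1}-(\alpha-1)^{k+1}\right)}{k+1}\right\}(-1)^{k-m}S_m^{(k)}$$ be the Binet polynomials, where $S_m^{(k)}$ is the (signed) Stirling number of the first kind, defined by $\prod_{j=0}^{m-1}(x-j)=\sum_{k=0}^m S_m^{(k)}x^k$; put $b_0(\alpha)=0$. Let $n\ge 0$ be an integer and let $z,\alpha\in\mathbb{C}$ satisfy $\operatorname{Re}(z)>0$ and $\operatorname{Re}(\alpha)>-\operatorname{Re}(z)$. Then $\mu$ is analytic at $z$, and its $n$-th derivative has the (absolutely) convergent factorial series $$\frac{d^n\mu(z)}{dz^n}=(-1)^n\sum_{m=n}^{\infty}\frac{\dfrac{d^n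 b_m(\alpha)}{d\alpha^n}}{\prod_{k=0}^{m-1}(z+\alpha+k)}.$$ -/

import Mathlib

noncomputable section

/-- The principal branch of `log Γ` on the plane cut along `(-∞, 0]`: the primitive of
`Γ' / Γ` that vanishes at `1`, written as an integral along the segment from `1` to `z`. -/
def logGamma (z : ℂ) : ℂ :=
  ∫ t in (0 : ℝ)..1, (z - 1) * Complex.digamma (1 + (t : ℂ) * (z - 1))

theorem slitPlane_isSimplyConnected : IsSimplyConnected Complex.slitPlane := by
  have : ContractibleSpace Complex.slitPlane :=
    Complex.starConvex_one_slitPlane.contractibleSpace ⟨1, by simp⟩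
  exact SimplyConnectedSpace.ofContractible Complex.slitPlane

theorem ne_neg_nat_of_mem_slitPlane {z : ℂ} (hz : z ∈ Complex.slitPlane) (m : ℕ) :
    z ≠ -(m : ℂ) := by
  rintro rfl
  rcases hz with h | h
  · simp only [Complex.neg_re, Complex.natCast_re] at h
    have : (0 : ℝ) ≤ m := Nat.cast_nonneg m
    linarith
  · simp at h

/-- `logGamma` is a holomorphic logarithm of `Γ` on the cut plane, with derivative `Γ' / Γ`. -/
theorem logGamma_spec {z : ℂ} (hz : z ∈ Complex.slitPlane) :
    Complex.exp (logGamma z) = Complex.Gamma z ∧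
      HasDerivAt logGamma (Complex.digamma z) z := by
  have hd : ∀ w ∈ Complex.slitPlane, DifferentiableAt ℂ Complex.Gamma w := fun w hw =>
    Complex.differentiableAt_Gamma w (ne_neg_nat_of_mem_slitPlane hw)
  have hne : ∀ w ∈ Complex.slitPlane, Complex.Gamma w ≠ 0 := fun w hw =>
    Complex.Gamma_ne_zero (ne_neg_nat_of_mem_slitPlane hw)
  obtain ⟨F, hFc, hF⟩ := Complex.exists_continuousOn_eqOn_exp_comp slitPlane_isSimplyConnected
    Complex.isOpen_slitPlane (g := Complex.Gamma)
    (fun w hw => (hd w hw).continuousAt.continuousWithinAt)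
    (by rintro ⟨w, hw, h0⟩; exact hne w hw h0)
  have hFd : ∀ w ∈ Complex.slitPlane, HasDerivAt F (Complex.digamma w) w := by
    intro w hw
    have hnhds : Complex.slitPlane ∈ nhds w := Complex.isOpen_slitPlane.mem_nhds hw
    have hcont : ContinuousAt F w := hFc.continuousAt hnhds
    have hlog : HasDerivAt (fun v => F w + Complex.log (Complex.Gamma v / Complex.Gamma w))
        (Complex.digamma w) w := by
      have h1 := ((hd w hw).hasDerivAt.div_const (Complex.Gamma w)).clog
        (by simp [div_self (hne w hw)])
      simpa [Complex.digamma_def, logDeriv_apply, div_self (hne w hw)] using h1.const_add (F w)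
    refine hlog.congr_of_eventuallyEq ?_
    have hball := hcont.eventually (Metric.ball_mem_nhds (F w) (by norm_num : (0 : ℝ) < 1))
    filter_upwards [hball, hnhds] with v hv hvs
    have hdist : |(F v - F w).im| < 1 :=
      lt_of_le_of_lt (Complex.abs_im_le_norm _) (by simpa [dist_eq_norm] using hv)
    rw [abs_lt] at hdist
    have hpi := Real.pi_gt_three
    have e : Complex.Gamma v / Complex.Gamma w = Complex.exp (F v - F w) := by
      rw [Complex.exp_sub]
      exact congrArg₂ _ (hF hvs).symm (hF hw).symm
    rw [e, Complex.log_exp (by linarith) (by linarith)]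
    ring
  have hdig : ContinuousOn Complex.digamma Complex.slitPlane := by
    have hG : DifferentiableOn ℂ Complex.Gamma Complex.slitPlane :=
      fun w hw => (hd w hw).differentiableWithinAt
    rw [Complex.digamma_def]
    exact ((hG.deriv Complex.isOpen_slitPlane).div hG hne).continuousOn
  have key : ∀ w ∈ Complex.slitPlane, logGamma w = F w - F 1 := by
    intro w hw
    have hmem : ∀ t ∈ Set.Icc (0 : ℝ) 1, 1 + t • (w - 1) ∈ Complex.slitPlane := fun t ht =>
      Complex.starConvex_one_slitPlane.add_smul_mem (by simpa using hw) ht.1 ht.2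
    have h := intervalIntegral.integral_unitInterval_deriv_eq_sub (f := F) (f' := Complex.digamma)
      (z₀ := 1) (z₁ := w - 1) (hdig.comp (by fun_prop) hmem) (fun t ht => hFd _ (hmem t ht))
    rw [logGamma, intervalIntegral.integral_const_mul]
    simpa using h
  have h1 : Complex.exp (F 1) = 1 := by
    have := hF (show (1 : ℂ) ∈ Complex.slitPlane by simp)
    simpa using this
  refine ⟨?_, ?_⟩
  · rw [key z hz, Complex.exp_sub, h1, div_one]
    exact hF hz
  · refine ((hFd z hz).sub_const (F 1)).congr_of_eventuallyEq ?_
    filter_upwards [Complex.isOpen_slitPlane.mem_nhds hz] with w hw using key w hw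

/-- Binet's function `μ(z) = log Γ(z) - (z - 1/2) log z + z - (1/2) log (2π)`. -/
def binetMu (z : ℂ) : ℂ :=
  logGamma z - (z - 1 / 2) * Complex.log z + z - 1 / 2 * Complex.log (2 * (Real.pi : ℂ))

/-- The signed Stirling number of the first kind `S_m^{(k)}`, the coefficient of `x ^ k` in
`x (x - 1) ⋯ (x - m + 1)`. Mathlib's `Nat.stirlingFirst` is its absolute value. -/
def stirlingS (m k : ℕ) : ℤ := (-1) ^ (m + k) * (Nat.stirlingFirst m k : ℤ)

/-- The Binet polynomial `b_m(α)`, with `b_0 = 0`. The sign `(-1) ^ (m + k)` is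
`(-1) ^ (k - m)`. -/
def binetPoly (m : ℕ) (α : ℂ) : ℂ :=
  1 / (m : ℂ) * ∑ k ∈ Finset.Icc 1 m,
    ((α ^ (k + 2) - (α - 1) ^ (k + 2)) / ((k : ℂ) + 2)
      + (1 / 2 - α) * (α ^ (k + 1) - (α - 1) ^ (k + 1)) / ((k : ℂ) + 1))
      * ((-1) ^ (m + k) * (stirlingS m k : ℂ))

end

/-! Write `(a)_m` for the rising factorial. The signless Stirling numbers are its coefficients, so
`m * b_m(α)` is the integral of `(1/2 - s) (α - s)_m` over `s ∈ [0, 1]`. Telescoping expands `1 / (c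
- a)` as `∑ (a)_m / (c)_{m+1}`. With `a = α - s` and `c = z + α`, this shows that the factorial
series satisfies the same difference equation in `z` as `μ` (`binetSeries_sub_binetSeries_add_one`,
`binetMu_sub_binetMu_add_one`).

Two solutions differ by a 1-periodic function, so it remains to show that both vanish along `z + N`.
The series does by dominated convergence. For `μ`, Stirling's formula and Euler's limit give `exp
μ(z + N) → 1`, and a connectedness argument removes the ambiguity in `2πiℤ`.

For derivatives, fix `c = z + α` and regard `μ(c - w) = ∑ b_m(w) / (c)_m` as a function of `w` near
`α`. Only the numerators move, and Weierstrass's theorem allows termwise differentiation. -/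

open Finset Filter Topology Asymptotics

/-! ### Binet polynomials as integrals of rising factorials -/

/-- The rising factorial `a (a + 1) ⋯ (a + m - 1)`. -/
def risingProd (m : ℕ) (a : ℂ) : ℂ := ∏ k ∈ range m, (a + k)

theorem risingProd_succ (m : ℕ) (a : ℂ) : risingProd (m + 1) a = risingProd m a * (a + m) :=
  prod_range_succ _ _

theorem continuous_risingProd (m : ℕ) : Continuous (risingProd m) := by
  unfold risingProd; fun_prop

theorem risingProd_eq_sum_stirlingFirst (m : ℕ) (a : ℂ) :
    risingProd m a = ∑ k ∈ range (m + 1), (Nat.stirlingFirst m k : ℂ) * a ^ k := by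
  induction m with
  | zero => simp [risingProd]
  | succ m ih =>
    have h0 : ∑ k ∈ range (m + 1), (Nat.stirlingFirst m k : ℂ) * a ^ k =
        ∑ k ∈ range (m + 1), (Nat.stirlingFirst m (k + 1) : ℂ) * a ^ (k + 1)
          + (Nat.stirlingFirst m 0 : ℂ) := by
      rw [sum_range_succ' , sum_range_succ _ m, Nat.stirlingFirst_eq_zero_of_lt (Nat.lt_succ_self m)]
      simp
    have hm : (m : ℂ) * (Nat.stirlingFirst m 0 : ℂ) = 0 := by cases m <;> simp
    rw [risingProd_succ, sum_range_succ', Nat.stirlingFirst_succ_zero]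
    simp only [Nat.stirlingFirst_succ_succ, Nat.cast_add, Nat.cast_mul, add_mul, sum_add_distrib,
      mul_assoc, ← mul_sum]
    rw [mul_add, mul_comm (risingProd m a) (m : ℂ)]
    nth_rewrite 2 [ih]
    rw [h0, mul_add, hm, ih, mul_comm _ a, mul_sum]
    have : ∀ k, a * ((Nat.stirlingFirst m k : ℂ) * a ^ k) = (Nat.stirlingFirst m k : ℂ) * a ^ (k + 1) :=
      fun k => by ring
    simp only [this]
    simp
    ring

theorem integral_half_sub_mul_pow (α : ℂ) (k : ℕ) :
    ∫ s in (0 : ℝ)..1, (1 / 2 - (s : ℂ)) * (α - s) ^ k =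
      (α ^ (k + 2) - (α - 1) ^ (k + 2)) / ((k : ℂ) + 2)
        + (1 / 2 - α) * (α ^ (k + 1) - (α - 1) ^ (k + 1)) / ((k : ℂ) + 1) := by
  have h1 : (k : ℂ) + 1 ≠ 0 := by exact_mod_cast k.succ_ne_zero
  have h2 : (k : ℂ) + 2 ≠ 0 := by exact_mod_cast (k + 1).succ_ne_zero
  have hd : ∀ s ∈ Set.uIcc (0 : ℝ) 1, HasDerivAt
      (fun s : ℝ => -((α - (s : ℂ)) ^ (k + 2) / ((k : ℂ) + 2)
        + (1 / 2 - α) * (α - (s : ℂ)) ^ (k + 1) / ((k : ℂ) + 1)))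
      ((1 / 2 - (s : ℂ)) * (α - s) ^ k) s := by
    intro s _
    have hs : HasDerivAt (fun s : ℝ => α - (s : ℂ)) (-1) s := by
      simpa using (Complex.ofRealCLM.hasDerivAt (x := s)).const_sub α
    convert! (((hs.pow (k + 2)).div_const ((k : ℂ) + 2)).add
      (((hs.pow (k + 1)).const_mul (1 / 2 - α)).div_const ((k : ℂ) + 1))).neg using 1
    push_cast
    field_simp
    ring
  rw [intervalIntegral.integral_eq_sub_of_hasDerivAt hd
    (Continuous.intervalIntegrable (by fun_prop) _ _)]
  simp
  ring

theorem binetPoly_eq_integral (m : ℕ) (α : ℂ) :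
    binetPoly m α = 1 / (m : ℂ) * ∫ s in (0 : ℝ)..1, (1 / 2 - (s : ℂ)) * risingProd m (α - s) := by
  rcases eq_or_ne m 0 with rfl | hm
  · simp [binetPoly]
  have hsum : ∀ s : ℝ, (1 / 2 - (s : ℂ)) * risingProd m (α - s) =
      ∑ k ∈ Icc 1 m, (Nat.stirlingFirst m k : ℂ) * ((1 / 2 - (s : ℂ)) * (α - s) ^ k) := by
    intro s
    rw [risingProd_eq_sum_stirlingFirst, mul_sum]
    -- The `k = 0` term drops out because `(a)_m` has no constant term when `m > 0`.
    have : range (m + 1) = insert 0 (Icc 1 m) := by ext; simp; omega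
    rw [this, sum_insert (by simp)]
    obtain ⟨n, rfl⟩ := Nat.exists_eq_succ_of_ne_zero hm
    simp only [Nat.stirlingFirst_succ_zero, Nat.cast_zero, zero_mul, mul_zero, zero_add]
    exact sum_congr rfl fun k _ => by ring
  simp only [hsum]
  rw [intervalIntegral.integral_finsetSum
    (fun k _ => Continuous.intervalIntegrable (by fun_prop) _ _), binetPoly]
  congr 1
  refine sum_congr rfl fun k _ => ?_
  rw [intervalIntegral.integral_const_mul, integral_half_sub_mul_pow, stirlingS, mul_comm]
  congr 1
  push_cast
  rw [← mul_assoc, ← pow_add, Even.neg_one_pow ⟨_, rfl⟩, one_mul]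

/-- The closed form has apparent degree `k + 2`; expanding under the integral gives the bound `k`,
which makes the terms `m < n` of the differentiated series vanish. -/
theorem exists_polynomial_integral_half_sub_mul_pow (k : ℕ) :
    ∃ p : Polynomial ℂ, p.natDegree ≤ k ∧
      ∀ α : ℂ, ∫ s in (0 : ℝ)..1, (1 / 2 - (s : ℂ)) * (α - s) ^ k = p.eval α := by
  refine ⟨∑ j ∈ range (k + 1), Polynomial.C
    (∫ s in (0 : ℝ)..1, (1 / 2 - (s : ℂ)) * (-(s : ℂ)) ^ (k - j) * (k.choose j : ℂ))
      * Polynomial.X ^ j, ?_, fun α => ?_⟩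
  · refine Polynomial.natDegree_sum_le_of_forall_le _ _ fun j hj => ?_
    exact (Polynomial.natDegree_C_mul_X_pow_le _ _).trans (by simpa [Nat.lt_succ_iff] using hj)
  · have : ∀ s : ℝ, (1 / 2 - (s : ℂ)) * (α - s) ^ k = ∑ j ∈ range (k + 1),
        ((1 / 2 - (s : ℂ)) * (-(s : ℂ)) ^ (k - j) * (k.choose j : ℂ)) * α ^ j := by
      intro s
      rw [sub_eq_add_neg α, add_pow, mul_sum]
      exact sum_congr rfl fun j _ => by ring
    simp only [this, Polynomial.eval_finsetSum, Polynomial.eval_mul, Polynomial.eval_C,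
      Polynomial.eval_pow, Polynomial.eval_X]
    rw [intervalIntegral.integral_finsetSum
      (fun k _ => Continuous.intervalIntegrable (by fun_prop) _ _)]
    exact sum_congr rfl fun j _ => intervalIntegral.integral_mul_const _ _

theorem exists_polynomial_binetPoly (m : ℕ) :
    ∃ p : Polynomial ℂ, p.natDegree ≤ m ∧ binetPoly m = fun α => p.eval α := by
  choose q hq hqe using exists_polynomial_integral_half_sub_mul_pow
  refine ⟨Polynomial.C (1 / (m : ℂ)) * ∑ k ∈ Icc 1 m,
    q k * Polynomial.C ((-1) ^ (m + k) * (stirlingS m k : ℂ)), ?_, ?_⟩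
  · refine (Polynomial.natDegree_C_mul_le _ _).trans
      (Polynomial.natDegree_sum_le_of_forall_le _ _ fun k hk => ?_)
    exact (Polynomial.natDegree_mul_C_le _ _).trans ((hq k).trans (mem_Icc.1 hk).2)
  · ext α
    simp only [binetPoly, Polynomial.eval_mul, Polynomial.eval_C, Polynomial.eval_finsetSum,
      ← integral_half_sub_mul_pow, hqe]

theorem differentiable_binetPoly (m : ℕ) : Differentiable ℂ (binetPoly m) := by
  obtain ⟨p, -, hp⟩ := exists_polynomial_binetPoly m
  rw [hp]
  exact p.differentiable

theorem iteratedDeriv_binetPoly_eq_zero {m n : ℕ} (h : m < n) (α : ℂ) :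
    iteratedDeriv n (binetPoly m) α = 0 := by
  obtain ⟨p, hdeg, hp⟩ := exists_polynomial_binetPoly m
  have : ∀ (n : ℕ) (q : Polynomial ℂ), iteratedDeriv n (fun α => q.eval α) =
      fun α => (Polynomial.derivative^[n] q).eval α := by
    intro n
    induction n with
    | zero => simp
    | succ n ih =>
      intro q
      have : deriv (fun α => q.eval α) = fun α => (Polynomial.derivative q).eval α := by
        ext; simp
      rw [iteratedDeriv_succ', this, ih, Function.iterate_succ_apply]
  rw [hp, this, Polynomial.iterate_derivative_eq_zero (lt_of_le_of_lt hdeg h)]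
  simp

/-! ### Growth of rising factorials and absolute convergence -/

/-- Factorwise comparison with one point, uniform in `a`. Growth depends on the real part, which is
not enlarged beyond `R`; the large imaginary part absorbs the factors with `a.re + k < 0`. -/
theorem norm_risingProd_le (m : ℕ) {a : ℂ} {R I : ℝ} (hR : a.re ≤ R) (hI : |a.re| + |a.im| ≤ I) :
    ‖risingProd m a‖ ≤ ‖risingProd m ⟨R, I⟩‖ := by
  simp only [risingProd, norm_prod]
  refine prod_le_prod (fun _ _ => norm_nonneg _) fun k _ => ?_
  have hk : (0 : ℝ) ≤ k := k.cast_nonneg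
  rcases le_total 0 (a.re + k) with h | h
  · rw [Complex.norm_def, Complex.norm_def]
    refine Real.sqrt_le_sqrt ?_
    simp only [Complex.normSq_apply, Complex.add_re, Complex.add_im, Complex.natCast_re,
      Complex.natCast_im, add_zero]
    have h1 : (a.re + k) * (a.re + k) ≤ (R + k) * (R + k) :=
      mul_self_le_mul_self h (by linarith)
    have h2 : a.im * a.im ≤ I * I := by
      rw [← abs_mul_abs_self a.im]
      exact mul_self_le_mul_self (abs_nonneg _) (by linarith [abs_nonneg a.re])
    linarith
  · have h1 : |a.re + k| ≤ |a.re| := by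
      rw [abs_of_nonpos h, abs_of_nonpos (by linarith)]; linarith
    calc ‖a + k‖ ≤ |(a + k).re| + |(a + k).im| := Complex.norm_le_abs_re_add_abs_im _
      _ ≤ I := by simpa using (add_le_add_left h1 _).trans hI
      _ ≤ |((⟨R, I⟩ : ℂ) + k).im| := by simpa using le_abs_self I
      _ ≤ _ := Complex.abs_im_le_norm _

theorem norm_risingProd_mono (m : ℕ) {c d : ℂ} (hd : 0 ≤ d.re) (hre : d.re ≤ c.re)
    (him : |d.im| ≤ |c.im|) : ‖risingProd m d‖ ≤ ‖risingProd m c‖ := by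
  simp only [risingProd, norm_prod]
  refine prod_le_prod (fun _ _ => norm_nonneg _) fun k _ => ?_
  have hk : (0 : ℝ) ≤ k := k.cast_nonneg
  rw [Complex.norm_def, Complex.norm_def]
  refine Real.sqrt_le_sqrt ?_
  simp only [Complex.normSq_apply, Complex.add_re, Complex.add_im, Complex.natCast_re,
    Complex.natCast_im, add_zero]
  have h1 : (d.re + k) * (d.re + k) ≤ (c.re + k) * (c.re + k) :=
    mul_self_le_mul_self (by linarith) (by linarith)
  have h2 : d.im * d.im ≤ c.im * c.im := by
    rw [← abs_mul_abs_self d.im, ← abs_mul_abs_self c.im]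
    exact mul_self_le_mul_self (abs_nonneg _) him
  linarith

theorem risingProd_ne_zero {a : ℂ} (ha : ∀ m : ℕ, a ≠ -m) (m : ℕ) : risingProd m a ≠ 0 :=
  prod_ne_zero_iff.2 fun k _ h => ha k (eq_neg_of_add_eq_zero_left h)

theorem ne_neg_nat_of_re_pos {z : ℂ} (hz : 0 < z.re) (m : ℕ) : z ≠ -(m : ℂ) :=
  ne_neg_nat_of_mem_slitPlane (Or.inl hz) m

/-- Euler's sequence `n ^ a n! / (a)_{n+1}` tends to `Γ(a) ≠ 0`, so the quotient of the sequences
for `c` and `a` is bounded. -/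
theorem isBigO_risingProd_div {a c : ℂ} (ha : ∀ m : ℕ, a ≠ -m) (hc : ∀ m : ℕ, c ≠ -m) :
    (fun n : ℕ => risingProd (n + 1) a / risingProd (n + 1) c) =O[atTop]
      fun n : ℕ => (n : ℝ) ^ (a.re - c.re) := by
  have hlim : Tendsto (fun n => Complex.GammaSeq c n / Complex.GammaSeq a n) atTop
      (𝓝 (Complex.Gamma c / Complex.Gamma a)) :=
    (Complex.GammaSeq_tendsto_Gamma c).div (Complex.GammaSeq_tendsto_Gamma a)
      (Complex.Gamma_ne_zero ha)
  have h1 : (fun n : ℕ => (n : ℂ) ^ (a - c) * (Complex.GammaSeq c n / Complex.GammaSeq a n))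
      =O[atTop] fun n : ℕ => (n : ℝ) ^ (a.re - c.re) * 1 := by
    refine IsBigO.mul (IsBigO.of_bound 1 ?_) (hlim.isBigO_one ℝ)
    filter_upwards [eventually_gt_atTop 0] with n hn
    rw [Complex.norm_natCast_cpow_of_pos hn, one_mul, Complex.sub_re]
    exact le_abs_self _
  refine (h1.congr' ?_ (by simp))
  filter_upwards [eventually_gt_atTop 0] with n hn
  have hn' : (n : ℂ) ≠ 0 := by exact_mod_cast hn.ne'
  have hA := risingProd_ne_zero ha (n + 1)
  have hC := risingProd_ne_zero hc (n + 1)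
  have hf : (n.factorial : ℂ) ≠ 0 := by exact_mod_cast n.factorial_ne_zero
  have e1 : (n : ℂ) ^ a ≠ 0 := by simp [Complex.cpow_eq_zero_iff, hn']
  have e2 : (n : ℂ) ^ c ≠ 0 := by simp [Complex.cpow_eq_zero_iff, hn']
  simp only [Complex.GammaSeq, Complex.cpow_sub _ _ hn']
  change _ / _ * ((n : ℂ) ^ c * n.factorial / risingProd (n + 1) c /
    ((n : ℂ) ^ a * n.factorial / risingProd (n + 1) a)) = _
  field_simp

theorem tendsto_risingProd_div {a c : ℂ} (ha : ∀ m : ℕ, a ≠ -m) (hc : ∀ m : ℕ, c ≠ -m)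
    (h : a.re < c.re) :
    Tendsto (fun n : ℕ => risingProd n a / risingProd n c) atTop (𝓝 0) := by
  rw [← tendsto_add_atTop_iff_nat 1]
  refine (isBigO_risingProd_div ha hc).trans_tendsto ?_
  have := (tendsto_rpow_neg_atTop (sub_pos.2 h)).comp tendsto_natCast_atTop_atTop
  simpa [Function.comp_def] using this

theorem summable_risingProd_div {a c : ℂ} (ha : ∀ m : ℕ, a ≠ -m) (hc : ∀ m : ℕ, c ≠ -m)
    (h : a.re < c.re) :
    Summable fun n : ℕ => 1 / (n : ℝ) * (‖risingProd n a‖ / ‖risingProd n c‖) := by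
  rw [← summable_nat_add_iff 1]
  have hs : Summable fun n : ℕ => (n : ℝ) ^ (a.re - c.re - 1) :=
    Real.summable_nat_rpow.2 (by linarith)
  refine summable_of_isBigO_nat hs ?_
  have h1 : (fun n : ℕ => 1 / ((n + 1 : ℕ) : ℝ)) =O[atTop] fun n : ℕ => (n : ℝ) ^ (-1 : ℝ) := by
    refine IsBigO.of_bound 1 ?_
    filter_upwards [eventually_gt_atTop 0] with n hn
    have : (0 : ℝ) < n := by exact_mod_cast hn
    rw [Real.rpow_neg_one, one_mul, one_div, norm_inv, norm_inv]
    refine inv_anti₀ (by simpa using hn) ?_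
    rw [Real.norm_of_nonneg (by positivity), Real.norm_of_nonneg (by positivity)]
    push_cast; linarith
  refine (h1.mul (isBigO_risingProd_div ha hc).norm_left).congr' ?_ ?_
  · exact Eventually.of_forall fun n => by simp
  · filter_upwards [eventually_gt_atTop 0] with n hn
    rw [← Real.rpow_add (by exact_mod_cast hn)]
    congr 1; ring

theorem ne_neg_nat_of_im_pos {R I : ℝ} (hI : 0 < I) (m : ℕ) : (⟨R, I⟩ : ℂ) ≠ -(m : ℂ) := by
  intro h
  have := congrArg Complex.im h
  simp at this
  exact hI.ne' this

theorem norm_half_sub_le {s : ℝ} (hs : s ∈ Set.Icc (0 : ℝ) 1) : ‖(1 / 2 - (s : ℂ))‖ ≤ 1 := by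
  rw [show (1 / 2 - (s : ℂ)) = ((1 / 2 - s : ℝ) : ℂ) by push_cast; ring, Complex.norm_real,
    Real.norm_eq_abs, abs_le]
  constructor <;> linarith [hs.1, hs.2]

theorem norm_binetPoly_le (m : ℕ) {α : ℂ} {R I : ℝ} (hR : α.re ≤ R)
    (hI : |α.re| + 1 + |α.im| ≤ I) :
    ‖binetPoly m α‖ ≤ 1 / (m : ℝ) * ‖risingProd m ⟨R, I⟩‖ := by
  rw [binetPoly_eq_integral, norm_mul]
  refine mul_le_mul (by simp) ?_ (norm_nonneg _) (by positivity)
  refine (intervalIntegral.norm_integral_le_of_norm_le_const (C := ‖risingProd m ⟨R, I⟩‖)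
    fun s hs => ?_).trans (by simp)
  rw [Set.uIoc_of_le zero_le_one] at hs
  rw [norm_mul]
  have h2 : ‖risingProd m (α - s)‖ ≤ ‖risingProd m ⟨R, I⟩‖ := by
    refine norm_risingProd_le m (by simp; linarith [hs.1]) ?_
    have : |α.re - s| ≤ |α.re| + 1 := by
      refine (abs_sub _ _).trans ?_
      rw [abs_of_pos hs.1]; linarith [hs.2]
    simp only [Complex.sub_re, Complex.ofReal_re, Complex.sub_im, Complex.ofReal_im, sub_zero]
    linarith
  calc _ ≤ 1 * _ := mul_le_mul (norm_half_sub_le ⟨hs.1.le, hs.2⟩) h2 (norm_nonneg _) zero_le_one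
    _ = _ := one_mul _

theorem summable_norm_binetPoly_div {α c : ℂ} (hc : 0 < c.re) (h : α.re < c.re) :
    Summable fun m : ℕ => ‖binetPoly m α / risingProd m c‖ := by
  have hI : 0 < |α.re| + 1 + |α.im| := by positivity
  refine Summable.of_nonneg_of_le (fun _ => norm_nonneg _) (fun m => ?_)
    (summable_risingProd_div (a := ⟨α.re, _⟩) (ne_neg_nat_of_im_pos hI) (ne_neg_nat_of_re_pos hc) h)
  rw [norm_div, ← mul_div_assoc]
  exact div_le_div_of_nonneg_right (norm_binetPoly_le m le_rfl le_rfl) (norm_nonneg _)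

/-! ### The factorial series: difference equation and decay -/

/-- The factorial series `∑ b_m(α) / ((z + α) (z + α + 1) ⋯ (z + α + m - 1))`. -/
noncomputable def binetSeries (α z : ℂ) : ℂ := ∑' m : ℕ, binetPoly m α / risingProd m (z + α)

/-- At `m = 0` this holds because `1/2 - s` has mean zero on `[0, 1]`. -/
theorem natCast_mul_binetPoly (m : ℕ) (α : ℂ) :
    (m : ℂ) * binetPoly m α = ∫ s in (0 : ℝ)..1, (1 / 2 - (s : ℂ)) * risingProd m (α - s) := by
  rw [binetPoly_eq_integral]
  rcases eq_or_ne m 0 with rfl | hm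
  · have := integral_half_sub_mul_pow α 0
    simp only [pow_zero, mul_one] at this
    simp only [risingProd, prod_range_zero, mul_one, this]
    simp
    ring
  · have : (m : ℂ) ≠ 0 := by exact_mod_cast hm
    field_simp

theorem risingProd_succ_left (m : ℕ) (a : ℂ) : risingProd (m + 1) a = a * risingProd m (a + 1) := by
  rw [risingProd, prod_range_succ', mul_comm, risingProd]
  simp only [Nat.cast_zero, add_zero, Nat.cast_add, Nat.cast_one]
  congr 1
  exact prod_congr rfl fun k _ => by ring

theorem inv_risingProd_sub_inv_risingProd {c : ℂ} (hc : ∀ m : ℕ, c ≠ -m) (m : ℕ) :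
    (risingProd m c)⁻¹ - (risingProd m (c + 1))⁻¹ = m / risingProd (m + 1) c := by
  have h0 := risingProd_ne_zero hc m
  have h1 := risingProd_ne_zero hc (m + 1)
  have h3 := h1
  rw [risingProd_succ_left] at h3
  have h2 := risingProd_succ m c
  rw [risingProd_succ_left] at h2
  rw [risingProd_succ_left, inv_sub_inv h0 (right_ne_zero_of_mul h3),
    div_eq_div_iff (mul_ne_zero h0 (right_ne_zero_of_mul h3)) h3]
  linear_combination risingProd m (c + 1) * h2

theorem sum_risingProd_div {a c : ℂ} (hc : ∀ m : ℕ, c ≠ -m) (hac : c - a ≠ 0) (M : ℕ) :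
    ∑ m ∈ range M, risingProd m a / risingProd (m + 1) c =
      (1 - risingProd M a / risingProd M c) / (c - a) := by
  induction M with
  | zero => simp [risingProd]
  | succ M ih =>
    have h0 := risingProd_ne_zero hc M
    have h1 := risingProd_ne_zero hc (M + 1)
    rw [risingProd_succ] at h1
    have h2 := right_ne_zero_of_mul h1
    rw [sum_range_succ, ih, risingProd_succ M c, risingProd_succ M a]
    field_simp
    ring

theorem integral_half_sub_div {z : ℂ} (hz : 0 < z.re) :
    ∫ s in (0 : ℝ)..1, (1 / 2 - (s : ℂ)) / (z + s) =
      (z + 1 / 2) * (Complex.log (z + 1) - Complex.log z) - 1 := by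
  have hpos : ∀ s ∈ Set.uIcc (0 : ℝ) 1, 0 < (z + (s : ℂ)).re := by
    intro s hs
    rw [Set.uIcc_of_le zero_le_one] at hs
    simp; linarith [hs.1]
  have hne : ∀ s ∈ Set.uIcc (0 : ℝ) 1, z + (s : ℂ) ≠ 0 := fun s hs h => by
    simpa [h] using hpos s hs
  have hd : ∀ s ∈ Set.uIcc (0 : ℝ) 1, HasDerivAt
      (fun s : ℝ => (z + 1 / 2) * Complex.log (z + s) - (s : ℂ))
      ((1 / 2 - (s : ℂ)) / (z + s)) s := by
    intro s hs
    have h1 : HasDerivAt (fun s : ℝ => (s : ℂ)) 1 s := by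
      simpa using (hasDerivAt_id s).ofReal_comp
    convert! (((h1.const_add z).clog_real (Or.inl (hpos s hs))).const_mul (z + 1 / 2)).sub h1
      using 1
    have := hne s hs
    field_simp
    ring
  rw [intervalIntegral.integral_eq_sub_of_hasDerivAt hd (ContinuousOn.intervalIntegrable
    (ContinuousOn.div (by fun_prop) (by fun_prop) hne))]
  simp
  ring

/-- Differencing `1 / (z + α)_m` produces a factor `m` that cancels the `1 / m` in `b_m`; the sum
then telescopes under the integral. The remainder involves `(α - s)_M / (z + α)_M`, which tends to
zero uniformly in `s` since `0 < z.re`. -/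
theorem binetSeries_sub_binetSeries_add_one {α z : ℂ} (hz : 0 < z.re) (hα : 0 < (z + α).re) :
    binetSeries α z - binetSeries α (z + 1) =
      (z + 1 / 2) * (Complex.log (z + 1) - Complex.log z) - 1 := by
  have hc := ne_neg_nat_of_re_pos hα
  have hs0 := (summable_norm_binetPoly_div hα (α := α) (by simpa using hz)).of_norm
  have hs1 := (summable_norm_binetPoly_div (α := α) (c := z + 1 + α)
    (by simp at hα ⊢; linarith) (by simp; linarith)).of_norm
  have hsum : HasSum (fun m : ℕ => m * binetPoly m α / risingProd (m + 1) (z + α))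
      (binetSeries α z - binetSeries α (z + 1)) := by
    refine (hs0.hasSum.sub hs1.hasSum).congr_fun fun m => ?_
    rw [show z + 1 + α = z + α + 1 by ring, div_eq_mul_inv (binetPoly m α),
      div_eq_mul_inv (binetPoly m α), ← mul_sub, inv_risingProd_sub_inv_risingProd hc]
    ring
  refine tendsto_nhds_unique hsum.tendsto_sum_nat ?_
  rw [← integral_half_sub_div hz]
  have hne : ∀ s ∈ Set.uIcc (0 : ℝ) 1, z + (s : ℂ) ≠ 0 := by
    intro s hs h
    rw [Set.uIcc_of_le zero_le_one] at hs
    have := congrArg Complex.re h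
    simp at this; linarith [hs.1]
  have hcont : ∀ M : ℕ, ContinuousOn (fun s : ℝ => (1 / 2 - (s : ℂ)) *
      (risingProd M (α - s) / risingProd M (z + α)) / (z + s)) (Set.uIcc (0 : ℝ) 1) := by
    intro M
    refine ContinuousOn.div (Continuous.continuousOn ?_) (by fun_prop) hne
    have := continuous_risingProd M
    fun_prop
  have hpart : ∀ M : ℕ, ∑ m ∈ range M, m * binetPoly m α / risingProd (m + 1) (z + α) =
      (∫ s in (0 : ℝ)..1, (1 / 2 - (s : ℂ)) / (z + s)) - ∫ s in (0 : ℝ)..1, (1 / 2 - (s : ℂ)) *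
        (risingProd M (α - s) / risingProd M (z + α)) / (z + s) := by
    intro M
    have hcont0 : ContinuousOn (fun s : ℝ => (1 / 2 - (s : ℂ)) / (z + s)) (Set.uIcc (0 : ℝ) 1) :=
      ContinuousOn.div (by fun_prop) (by fun_prop) hne
    rw [← intervalIntegral.integral_sub hcont0.intervalIntegrable (hcont M).intervalIntegrable]
    simp only [natCast_mul_binetPoly, ← intervalIntegral.integral_div]
    rw [← intervalIntegral.integral_finsetSum]
    · refine intervalIntegral.integral_congr fun s hs => ?_
      have := sum_risingProd_div (a := α - s) (c := z + α) hc
        (by rw [show z + α - (α - s) = z + s by ring]; exact hne s hs) M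
      rw [show z + α - (α - s) = z + s by ring] at this
      simp only [mul_div_assoc, ← mul_sum, this]
      ring
    · intro m _
      have := continuous_risingProd m
      exact Continuous.intervalIntegrable (by fun_prop) _ _
  simp only [hpart]
  have hI : 0 < |α.re| + 1 + |α.im| := by positivity
  have hlim := (tendsto_risingProd_div (a := ⟨α.re, _⟩) (ne_neg_nat_of_im_pos hI) hc
    (by simpa using hz)).norm.div_const z.re
  rw [norm_zero, zero_div] at hlim
  have herr : Tendsto (fun M : ℕ => ∫ s in (0 : ℝ)..1, (1 / 2 - (s : ℂ)) *
        (risingProd M (α - s) / risingProd M (z + α)) / (z + s)) atTop (𝓝 0) := by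
    refine squeeze_zero_norm (fun M => ?_) hlim
    refine (intervalIntegral.norm_integral_le_of_norm_le_const fun s hs => ?_).trans
      (by rw [sub_zero, abs_one, mul_one])
    rw [Set.uIoc_of_le zero_le_one] at hs
    rw [norm_div, norm_mul]
    refine div_le_div₀ (norm_nonneg _) ?_ hz ?_
    · refine (mul_le_mul (norm_half_sub_le ⟨hs.1.le, hs.2⟩) ?_ (norm_nonneg _) zero_le_one).trans
        (one_mul _).le
      rw [norm_div, norm_div]
      refine div_le_div_of_nonneg_right (norm_risingProd_le M ?_ ?_) (norm_nonneg _)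
      · simp; linarith [hs.1]
      · have : |α.re - s| ≤ |α.re| + 1 := by
          refine (abs_sub _ _).trans ?_
          rw [abs_of_pos hs.1]; linarith [hs.2]
        simp only [Complex.sub_re, Complex.ofReal_re, Complex.sub_im, Complex.ofReal_im, sub_zero]
        linarith
    · refine le_trans ?_ (Complex.re_le_norm _)
      simp; linarith [hs.1]
  simpa using tendsto_const_nhds.sub herr

theorem tendsto_binetSeries_add_natCast {α z : ℂ} (hz : 0 < z.re) (hα : 0 < (z + α).re) :
    Tendsto (fun N : ℕ => binetSeries α (z + N)) atTop (𝓝 0) := by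
  have hs := summable_norm_binetPoly_div hα (α := α) (by simpa using hz)
  have hc := ne_neg_nat_of_re_pos hα
  have hmono : ∀ N m : ℕ, ‖risingProd m (z + α)‖ ≤ ‖risingProd m (z + N + α)‖ := fun N m =>
    norm_risingProd_mono m hα.le (by simp) (by simp)
  have hpos : ∀ m : ℕ, 0 < ‖risingProd m (z + α)‖ := fun m => norm_pos_iff.2 (risingProd_ne_zero hc m)
  have := tendsto_tsum_of_dominated_convergence (𝓕 := atTop) (g := fun _ : ℕ => (0 : ℂ))
    (f := fun N m : ℕ => binetPoly m α / risingProd m (z + N + α)) hs ?_ ?_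
  · simpa [binetSeries] using this
  · intro m
    -- The term `m = 0` has an empty denominator and vanishes only because `b_0 = 0`; for `m = n +
    -- 1` the last factor has real part at least `N`.
    cases m with
    | zero => simp [binetPoly]
    | succ n =>
      have hN : Tendsto (fun N : ℕ => ‖binetPoly (n + 1) α‖ / ‖risingProd n (z + α)‖ / (N : ℝ))
          atTop (𝓝 0) := tendsto_const_div_atTop_nhds_zero_nat _
      refine squeeze_zero_norm' ?_ hN
      filter_upwards [eventually_gt_atTop 0] with N hN
      have hN' : (0 : ℝ) < N := by exact_mod_cast hN
      rw [norm_div, risingProd_succ, norm_mul, div_div]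
      refine div_le_div_of_nonneg_left (norm_nonneg _) (mul_pos (hpos n) hN') ?_
      refine mul_le_mul (hmono N n) ((?_ : (N : ℝ) ≤ _).trans (Complex.re_le_norm _)) hN'.le
        (norm_nonneg _)
      have h0 : (0 : ℝ) ≤ n := n.cast_nonneg
      simp at hα ⊢; linarith
  · refine Eventually.of_forall fun N m => ?_
    rw [norm_div, norm_div]
    exact div_le_div_of_nonneg_left (norm_nonneg _) (hpos m) (hmono N m)

/-! ### Fixing the branch: `log Γ` on the right half-plane -/

/-- The function `f.im / (2π)` is continuous and integer-valued, hence constant on a preconnected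
set. -/
theorem eq_zero_of_exp_eq_one {X : Type*} [TopologicalSpace X] {S : Set X} (hS : IsPreconnected S)
    {f : X → ℂ} (hf : ContinuousOn f S) (hexp : ∀ x ∈ S, Complex.exp (f x) = 1) {x₀ : X}
    (hx₀ : x₀ ∈ S) (h0 : (f x₀).im = 0) {x : X} (hx : x ∈ S) : f x = 0 := by
  have hmaps : Set.MapsTo (fun x => (f x).im / (2 * Real.pi)) S (Set.range ((↑) : ℤ → ℝ)) := by
    intro y hy
    obtain ⟨n, hn⟩ := Complex.exp_eq_one_iff.1 (hexp y hy)
    refine ⟨n, ?_⟩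
    simp [hn]
  have hT : IsDiscrete (Set.range ((↑) : ℤ → ℝ)) :=
    Int.isClosedEmbedding_coe_real.isEmbedding.isDiscrete_range
  have hcont : ContinuousOn (fun x => (f x).im / (2 * Real.pi)) S :=
    (Complex.continuous_im.comp_continuousOn hf).div_const _
  have h := hS.constant_of_mapsTo hT hcont hmaps hx hx₀
  simp only [h0, zero_div] at h
  obtain ⟨n, hn⟩ := Complex.exp_eq_one_iff.1 (hexp x hx)
  rw [hn] at h ⊢
  have : n = 0 := by simpa using h
  simp [this]

theorem mem_slitPlane_of_re_pos {z : ℂ} (hz : 0 < z.re) : z ∈ Complex.slitPlane := Or.inl hz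

theorem continuousAt_logGamma {z : ℂ} (hz : 0 < z.re) : ContinuousAt logGamma z :=
  (logGamma_spec (mem_slitPlane_of_re_pos hz)).2.continuousAt

theorem exp_logGamma {z : ℂ} (hz : 0 < z.re) : Complex.exp (logGamma z) = Complex.Gamma z :=
  (logGamma_spec (mem_slitPlane_of_re_pos hz)).1

theorem logGamma_one : logGamma 1 = 0 := by simp [logGamma]

theorem logGamma_ofReal {x : ℝ} (hx : 0 < x) : logGamma x = (Real.log (Real.Gamma x) : ℂ) := by
  refine sub_eq_zero.1 (eq_zero_of_exp_eq_one (S := Set.Ioi (0 : ℝ)) isPreconnected_Ioi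
    (f := fun x : ℝ => logGamma x - (Real.log (Real.Gamma x) : ℂ)) ?_ ?_ (x₀ := 1) ?_ ?_ hx)
  · intro y (hy : 0 < y)
    have h1 : ContinuousAt (fun x : ℝ => logGamma (x : ℂ)) y :=
      ContinuousAt.comp (f := fun x : ℝ => (x : ℂ))
        (continuousAt_logGamma (by simpa using hy)) Complex.continuous_ofReal.continuousAt
    have h2 : ContinuousAt Real.Gamma y :=
      (Real.differentiableAt_Gamma fun m h => by
        have : (0 : ℝ) ≤ m := m.cast_nonneg
        linarith).continuousAt
    exact (h1.sub (Complex.continuous_ofReal.continuousAt.comp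
      (h2.log (Real.Gamma_pos_of_pos hy).ne'))).continuousWithinAt
  · intro y (hy : 0 < y)
    have := Real.Gamma_pos_of_pos hy
    rw [Complex.exp_sub, exp_logGamma (by simpa using hy), ← Complex.ofReal_exp, Real.exp_log this,
      Complex.Gamma_ofReal, div_self (by exact_mod_cast this.ne')]
  · simp
  · simp [logGamma_one]

theorem isPreconnected_re_pos : IsPreconnected {z : ℂ | 0 < z.re} :=
  (convex_halfSpace_re_gt 0).isPreconnected

theorem logGamma_add_one {z : ℂ} (hz : 0 < z.re) :
    logGamma (z + 1) = logGamma z + Complex.log z := by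
  rw [← sub_eq_zero, ← sub_sub]
  refine eq_zero_of_exp_eq_one isPreconnected_re_pos
    (f := fun z => logGamma (z + 1) - logGamma z - Complex.log z) ?_ ?_ (x₀ := 1) ?_ ?_ hz
  · intro y (hy : 0 < y.re)
    have h1 : ContinuousAt (fun x : ℂ => logGamma (x + 1)) y :=
      ContinuousAt.comp (f := fun x : ℂ => x + 1)
        (continuousAt_logGamma (by simp; linarith)) (by fun_prop)
    exact ((h1.sub (continuousAt_logGamma hy)).sub
      (continuousAt_clog (mem_slitPlane_of_re_pos hy))).continuousWithinAt
  · intro y (hy : 0 < y.re)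
    have hy0 : y ≠ 0 := fun h => by simp [h] at hy
    have := Complex.Gamma_ne_zero (ne_neg_nat_of_re_pos hy)
    rw [Complex.exp_sub, Complex.exp_sub, exp_logGamma hy, Complex.exp_log hy0,
      exp_logGamma (by simp; linarith), Complex.Gamma_add_one y hy0]
    field_simp
  · simp
  · have := logGamma_ofReal (x := 1 + 1) (by norm_num)
    push_cast at this
    simp [logGamma_one, this]

theorem binetMu_sub_binetMu_add_one {z : ℂ} (hz : 0 < z.re) :
    binetMu z - binetMu (z + 1) = (z + 1 / 2) * (Complex.log (z + 1) - Complex.log z) - 1 := by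
  simp only [binetMu, logGamma_add_one hz]
  ring

/-! ### Stirling's formula for `exp μ(z + N)` -/

theorem Gamma_add_natCast {z : ℂ} (hz : ∀ m : ℕ, z ≠ -m) (N : ℕ) :
    Complex.Gamma (z + N) = Complex.Gamma z * risingProd N z := by
  induction N with
  | zero => simp [risingProd]
  | succ N ih =>
    rw [risingProd_succ, ← mul_assoc, ← ih, Nat.cast_add, Nat.cast_one, ← add_assoc,
      Complex.Gamma_add_one _ fun h => hz N (eq_neg_of_add_eq_zero_left h), mul_comm]

theorem tendsto_natCast_mul_log_one_add_div (z : ℂ) :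
    Tendsto (fun N : ℕ => (N : ℂ) * Complex.log (1 + z / N)) atTop (𝓝 z) := by
  have h : Tendsto (fun x : ℝ => (x : ℂ) * (z / (x : ℂ))) atTop (𝓝 z) := by
    refine tendsto_const_nhds.congr' ?_
    filter_upwards [eventually_ne_atTop 0] with x hx
    have : (x : ℂ) ≠ 0 := by exact_mod_cast hx
    field_simp
  simpa [Function.comp_def] using
    (Complex.tendsto_mul_log_one_add_of_tendsto h).comp tendsto_natCast_atTop_atTop

theorem exp_binetMu {z : ℂ} (hz : 0 < z.re) :
    Complex.exp (binetMu z) = Complex.Gamma z * Complex.exp (-((z - 1 / 2) * Complex.log z) + z) *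
      Complex.exp (-(1 / 2 * Complex.log (2 * (Real.pi : ℂ)))) := by
  rw [← exp_logGamma hz, ← Complex.exp_add, ← Complex.exp_add, binetMu]
  ring_nf

theorem ofReal_sqrt_eq_exp {x : ℝ} (hx : 0 < x) :
    ((√x : ℝ) : ℂ) = Complex.exp (1 / 2 * Complex.log x) := by
  rw [← Complex.ofReal_log hx.le, Real.sqrt_eq_rpow, Real.rpow_def_of_pos hx]
  push_cast
  ring_nf

theorem natCast_factorial_eq_stirlingSeq {N : ℕ} (hN : 0 < N) :
    (N.factorial : ℂ) = Stirling.stirlingSeq N * ((√2 : ℝ) : ℂ) *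
      Complex.exp ((N + 1 / 2) * Complex.log N - N) := by
  have hN' : (0 : ℝ) < N := by exact_mod_cast hN
  have h2 : (N : ℂ) ≠ 0 := by exact_mod_cast hN.ne'
  have h1 : (N.factorial : ℝ) = Stirling.stirlingSeq N * (√(2 * N) * (N / Real.exp 1) ^ N) := by
    rw [Stirling.stirlingSeq, div_mul_cancel₀]
    positivity
  have h3 := congrArg ((↑) : ℝ → ℂ) h1
  rw [Real.sqrt_mul zero_le_two] at h3
  push_cast at h3
  have h4 : ((N : ℂ) / Complex.exp 1) ^ N = Complex.exp (N * (Complex.log N - 1)) := by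
    rw [Complex.exp_nat_mul, Complex.exp_sub, Complex.exp_log h2]
  rw [h3, ofReal_sqrt_eq_exp hN', h4, mul_assoc, mul_assoc, ← Complex.exp_add,
    Complex.ofReal_natCast]
  ring_nf

/-- Trading `(z)_N` for Euler's sequence and `N!` for Stirling's cancels all powers of `N`, leaving
factors with known limits. -/
theorem exp_binetMu_add_natCast {z : ℂ} (hz : 0 < z.re) {N : ℕ} (hN : 0 < N) :
    Complex.exp (binetMu (z + N)) = Complex.Gamma z / Complex.GammaSeq z N *
      (Stirling.stirlingSeq N * ((√2 : ℝ) : ℂ)) / (1 + z / N) *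
      Complex.exp (z - ((z - 1 / 2) * Complex.log (1 + z / N) + N * Complex.log (1 + z / N))) *
      Complex.exp (-(1 / 2 * Complex.log (2 * (Real.pi : ℂ)))) := by
  have hN' : (0 : ℝ) < N := by exact_mod_cast hN
  have hN0 : (N : ℂ) ≠ 0 := by exact_mod_cast hN.ne'
  have hzN : z + N = ((N : ℝ) : ℂ) * (1 + z / N) := by push_cast; field_simp; ring
  have hzpos : 0 < (z + N).re := by simp; linarith
  have hzN0 : z + N ≠ 0 := fun h => by rw [h] at hzpos; simp at hzpos
  have h1 : 1 + z / N ≠ 0 := fun h => hzN0 (by rw [hzN, h, mul_zero])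
  have hlog : Complex.log (z + N) = Complex.log N + Complex.log (1 + z / N) := by
    rw [hzN, Complex.log_ofReal_mul hN' h1, Complex.ofReal_log hN'.le, Complex.ofReal_natCast]
  have hP := risingProd_ne_zero (ne_neg_nat_of_re_pos hz) N
  have hG : Complex.GammaSeq z N = Complex.exp (Complex.log N * z) * N.factorial /
      (risingProd N z * (N * (1 + z / N))) := by
    rw [Complex.ofReal_natCast] at hzN
    rw [← Complex.cpow_def_of_ne_zero hN0, ← hzN, ← risingProd_succ]
    rfl
  have hf : (N.factorial : ℂ) ≠ 0 := by exact_mod_cast N.factorial_ne_zero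
  have hst := natCast_factorial_eq_stirlingSeq hN
  have hexp : Complex.exp (-((z + N - 1 / 2) * Complex.log (z + N)) + (z + N)) =
      Complex.exp (z - ((z - 1 / 2) * Complex.log (1 + z / N) + N * Complex.log (1 + z / N))) *
        N / (Complex.exp (Complex.log N * z) *
        Complex.exp ((N + 1 / 2) * Complex.log N - N)) := by
    have hmul : ∀ w : ℂ, Complex.exp w * N = Complex.exp (w + Complex.log N) := fun w => by
      rw [Complex.exp_add, Complex.exp_log hN0]
    rw [hmul, ← Complex.exp_add, ← Complex.exp_sub, hlog]
    ring_nf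
  have hst0 : (Stirling.stirlingSeq N : ℂ) * ((√2 : ℝ) : ℂ) ≠ 0 := by
    intro h; rw [h, zero_mul] at hst; exact hf hst
  rw [exp_binetMu hzpos, Gamma_add_natCast (ne_neg_nat_of_re_pos hz), hexp, hG, hst]
  congr 1
  have hst1 := left_ne_zero_of_mul hst0
  have hst2 := right_ne_zero_of_mul hst0
  have hsum0 : (N : ℂ) + z ≠ 0 := by rwa [add_comm]
  field_simp [Complex.exp_ne_zero]

theorem tendsto_exp_binetMu_add_natCast {z : ℂ} (hz : 0 < z.re) :
    Tendsto (fun N : ℕ => Complex.exp (binetMu (z + N))) atTop (𝓝 1) := by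
  have hG := Complex.Gamma_ne_zero (ne_neg_nat_of_re_pos hz)
  have h1 : Tendsto (fun N : ℕ => 1 + z / (N : ℂ)) atTop (𝓝 1) := by
    simpa using (tendsto_const_div_atTop_nhds_zero_nat z).const_add 1
  have h2 : Tendsto (fun N : ℕ => Complex.log (1 + z / (N : ℂ))) atTop (𝓝 0) := by
    simpa using h1.clog (by simp)
  have h3 : Tendsto (fun N : ℕ => Complex.exp (z - ((z - 1 / 2) * Complex.log (1 + z / N)
      + N * Complex.log (1 + z / N)))) atTop (𝓝 1) := by
    have := ((h2.const_mul (z - 1 / 2)).add (tendsto_natCast_mul_log_one_add_div z)).const_sub z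
    simpa using this.cexp
  have h4 : Tendsto (fun N : ℕ => ((Stirling.stirlingSeq N : ℝ) : ℂ)) atTop
      (𝓝 ((√Real.pi : ℝ) : ℂ)) :=
    (Complex.continuous_ofReal.tendsto _).comp Stirling.tendsto_stirlingSeq_sqrt_pi
  have h5 := (((((tendsto_const_nhds (x := Complex.Gamma z)).div (Complex.GammaSeq_tendsto_Gamma z) hG).mul
    (h4.mul_const ((√2 : ℝ) : ℂ))).div h1 one_ne_zero).mul h3).mul_const
      (Complex.exp (-(1 / 2 * Complex.log (2 * (Real.pi : ℂ)))))
  have hval : Complex.Gamma z / Complex.Gamma z * (((√Real.pi : ℝ) : ℂ) * ((√2 : ℝ) : ℂ)) / 1 * 1 *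
      Complex.exp (-(1 / 2 * Complex.log (2 * (Real.pi : ℂ)))) = 1 := by
    have := ofReal_sqrt_eq_exp (x := 2 * Real.pi) (by positivity)
    push_cast at this
    rw [div_self hG, Complex.exp_neg, ← this, Real.sqrt_mul zero_le_two]
    have ha : ((√Real.pi : ℝ) : ℂ) ≠ 0 := by
      exact_mod_cast (Real.sqrt_pos.2 Real.pi_pos).ne'
    have hb : ((√2 : ℝ) : ℂ) ≠ 0 := by exact_mod_cast (Real.sqrt_pos.2 zero_lt_two).ne'
    push_cast
    field_simp
  rw [hval] at h5
  refine h5.congr' ?_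
  filter_upwards [eventually_gt_atTop 0] with N hN
  exact (exp_binetMu_add_natCast hz hN).symm

/-! ### Identification of the series with `μ` -/

theorem tendsto_binetMu_add_natCast_sub {α z : ℂ} (hz : 0 < z.re) (hα : 0 < (z + α).re) :
    Tendsto (fun N : ℕ => binetMu (z + N)) atTop (𝓝 (binetMu z - binetSeries α z)) := by
  have h : ∀ N : ℕ, binetMu (z + N) = binetMu z - binetSeries α z + binetSeries α (z + N) := by
    intro N
    induction N with
    | zero => simp
    | succ N ih =>
      have hN : (0 : ℝ) ≤ N := N.cast_nonneg
      have h1 : 0 < (z + N).re := by simp; linarith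
      have h2 := binetMu_sub_binetMu_add_one h1
      have h3 : 0 < (z + N + α).re := by simp at hα ⊢; linarith
      rw [← binetSeries_sub_binetSeries_add_one h1 h3] at h2
      push_cast
      rw [← add_assoc]
      linear_combination ih - h2
  simp only [h]
  simpa using (tendsto_binetSeries_add_natCast hz hα).const_add (binetMu z - binetSeries α z)

theorem differentiableAt_binetMu {z : ℂ} (hz : z ∈ Complex.slitPlane) :
    DifferentiableAt ℂ binetMu z := by
  have h1 := (logGamma_spec hz).2.differentiableAt
  have h2 := differentiableAt_id.clog hz
  unfold binetMu
  simp only [id_eq] at h2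
  fun_prop

theorem continuousAt_binetSeries_zero {z : ℂ} (hz : 0 < z.re) :
    ContinuousAt (binetSeries 0) z := by
  have hδ : 0 < ((z.re / 2 : ℝ) : ℂ).re := by simpa using hz
  have hU : IsOpen {w : ℂ | z.re / 2 < w.re} := isOpen_lt continuous_const Complex.continuous_re
  refine ContinuousOn.continuousAt (s := {w : ℂ | z.re / 2 < w.re}) ?_
    (hU.mem_nhds (by simpa using hz))
  refine continuousOn_tsum (fun m => ?_)
    (summable_norm_binetPoly_div hδ (α := 0) (by simpa using hz)) fun m w hw => ?_
  · refine ContinuousOn.div continuousOn_const ?_ fun w hw => ?_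
    · have := continuous_risingProd m
      fun_prop
    · refine risingProd_ne_zero (ne_neg_nat_of_re_pos ?_) m
      simp at hw ⊢; linarith
  · rw [norm_div, norm_div]
    refine div_le_div_of_nonneg_left (norm_nonneg _)
      (norm_pos_iff.2 (risingProd_ne_zero (ne_neg_nat_of_re_pos hδ) m))
      (norm_risingProd_mono m hδ.le ?_ ?_)
    · simp at hw ⊢; linarith
    · simp

theorem conj_binetPoly (m : ℕ) (α : ℂ) :
    (starRingEnd ℂ) (binetPoly m α) = binetPoly m ((starRingEnd ℂ) α) := by
  simp [binetPoly, map_sum, map_div₀, map_ofNat]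

theorem conj_binetSeries (α z : ℂ) :
    (starRingEnd ℂ) (binetSeries α z) =
      binetSeries ((starRingEnd ℂ) α) ((starRingEnd ℂ) z) := by
  simp [binetSeries, Complex.conj_tsum, conj_binetPoly, risingProd, map_div₀, map_prod]

/-- The limit does not involve `α`, so `α = 0` suffices. The difference of `μ` and that series is
continuous with exponential 1, and real at `z = 1`. -/
theorem tendsto_binetMu_add_natCast {z : ℂ} (hz : 0 < z.re) :
    Tendsto (fun N : ℕ => binetMu (z + N)) atTop (𝓝 0) := by
  have hlim : ∀ {w : ℂ}, 0 < w.re →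
      Tendsto (fun N : ℕ => binetMu (w + N)) atTop (𝓝 (binetMu w - binetSeries 0 w)) :=
    fun hw => tendsto_binetMu_add_natCast_sub hw (by simpa using hw)
  have hzero : binetMu z - binetSeries 0 z = 0 := by
    refine eq_zero_of_exp_eq_one isPreconnected_re_pos
      (f := fun w => binetMu w - binetSeries 0 w) ?_ ?_ (x₀ := 1) ?_ ?_ hz
    · intro w (hw : 0 < w.re)
      exact ((differentiableAt_binetMu (mem_slitPlane_of_re_pos hw)).continuousAt.sub
        (continuousAt_binetSeries_zero hw)).continuousWithinAt
    · intro w (hw : 0 < w.re)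
      exact tendsto_nhds_unique (hlim hw).cexp (tendsto_exp_binetMu_add_natCast hw)
    · simp
    -- The series commutes with conjugation, hence is real at real arguments.
    · have h1 : (binetSeries 0 1).im = 0 := by
        rw [← Complex.conj_eq_iff_im, conj_binetSeries]
        simp
      have h2 : Complex.log (2 * (Real.pi : ℂ)) = (Real.log (2 * Real.pi) : ℂ) := by
        rw [Complex.ofReal_log (by positivity)]; push_cast; rfl
      have h3 : (binetMu 1).im = 0 := by
        simp [binetMu, logGamma_one, h2]
      simp [h1, h3]
  exact hzero ▸ hlim hz

theorem binetSeries_eq_binetMu {α z : ℂ} (hz : 0 < z.re) (hα : 0 < (z + α).re) :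
    binetSeries α z = binetMu z :=
  (sub_eq_zero.1 (tendsto_nhds_unique (tendsto_binetMu_add_natCast_sub hz hα)
    (tendsto_binetMu_add_natCast hz))).symm

/-! ### Termwise differentiation in `α` -/

theorem tendstoLocallyUniformlyOn_iteratedDeriv {ι : Type*} {p : Filter ι} [p.NeBot]
    {F : ι → ℂ → ℂ} {f : ℂ → ℂ} {U : Set ℂ} (hU : IsOpen U)
    (hF : ∀ i, DifferentiableOn ℂ (F i) U) (hf : TendstoLocallyUniformlyOn F f p U) (n : ℕ) :
    TendstoLocallyUniformlyOn (fun i => iteratedDeriv n (F i)) (iteratedDeriv n f) p U := by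
  induction n generalizing F f with
  | zero => simpa using hf
  | succ n ih =>
    simp only [iteratedDeriv_succ']
    exact ih (fun i => (hF i).deriv hU) (hf.deriv (Eventually.of_forall hF) hU)

theorem hasSum_iteratedDeriv_of_summable_norm {ι : Type*} {u : ι → ℝ} {F : ι → ℂ → ℂ} {U : Set ℂ}
    (hu : Summable u) (hF : ∀ i, Differentiable ℂ (F i)) (hU : IsOpen U)
    (hF_le : ∀ i, ∀ w ∈ U, ‖F i w‖ ≤ u i) {z : ℂ} (hz : z ∈ U) (n : ℕ) :
    HasSum (fun i => iteratedDeriv n (F i) z) (iteratedDeriv n (fun w => ∑' i, F i w) z) := by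
  have h := (tendstoLocallyUniformlyOn_iteratedDeriv hU
    (fun t : Finset ι => DifferentiableOn.fun_sum fun i _ => (hF i).differentiableOn)
    (tendstoUniformlyOn_tsum hu hF_le).tendstoLocallyUniformlyOn n).tendsto_at hz
  refine h.congr fun t => ?_
  exact iteratedDeriv_fun_sum fun i _ => (hF i).contDiff.contDiffAt

theorem mainTheorem5 (n : ℕ) (z α : ℂ) (hz : 0 < z.re) (hα : -z.re < α.re) :
    AnalyticAt ℂ binetMu z ∧
    HasSum
      (fun j : ℕ => (-1 : ℂ) ^ n *
        (iteratedDeriv n (binetPoly (n + j)) α / ∏ k ∈ Finset.range (n + j), (z + α + (k : ℂ))))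
      (iteratedDeriv n binetMu z) := by
  refine ⟨DifferentiableOn.analyticAt (s := Complex.slitPlane)
    (fun w hw => (differentiableAt_binetMu hw).differentiableWithinAt)
    (Complex.isOpen_slitPlane.mem_nhds (mem_slitPlane_of_re_pos hz)), ?_⟩
  have hc : 0 < (z + α).re := by simp; linarith
  -- This radius keeps `α.re + ε < (z + α).re`, so a single summable majorant serves the whole ball;
  -- `I` bounds `|w.re| + 1 + |w.im|` there.
  set ε : ℝ := z.re / 2 with hε
  have hε0 : 0 < ε := half_pos hz
  set I : ℝ := |α.re| + |α.im| + 2 * ε + 1 with hI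
  have hI0 : 0 < I := by positivity
  have hball : ∀ w ∈ Metric.ball α ε, |w.re - α.re| < ε ∧ |w.im - α.im| < ε := by
    intro w hw
    rw [Metric.mem_ball, dist_eq_norm] at hw
    exact ⟨by simpa using (Complex.abs_re_le_norm (w - α)).trans_lt hw,
      by simpa using (Complex.abs_im_le_norm (w - α)).trans_lt hw⟩
  have hsum := hasSum_iteratedDeriv_of_summable_norm (U := Metric.ball α ε)
    (F := fun m w => binetPoly m w / risingProd m (z + α))
    (summable_risingProd_div (a := ⟨α.re + ε, I⟩) (c := z + α) (ne_neg_nat_of_im_pos hI0)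
      (ne_neg_nat_of_re_pos hc) (by simp; linarith))
    (fun m => (differentiable_binetPoly m).div_const _) Metric.isOpen_ball ?_
    (Metric.mem_ball_self hε0) n
  -- The series is applied with parameter `w` at the point `z + α - w`, so its denominators stay
  -- constant.
  · have heq : (fun w => ∑' m, binetPoly m w / risingProd m (z + α)) =ᶠ[𝓝 α]
        fun w => binetMu (z + α - w) := by
      filter_upwards [Metric.ball_mem_nhds α hε0] with w hw
      have hw1 := (abs_lt.1 (hball w hw).1).2
      rw [← binetSeries_eq_binetMu (α := w) (by simp; linarith) (by simpa using hc), binetSeries,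
        sub_add_cancel]
    rw [heq.iteratedDeriv_eq, iteratedDeriv_comp_const_sub] at hsum
    simp only [iteratedDeriv_div_const, add_sub_cancel_right] at hsum
    have hshift := (hasSum_nat_add_iff' n).2 hsum
    rw [sum_eq_zero fun m hm => by
      rw [iteratedDeriv_binetPoly_eq_zero (mem_range.1 hm), zero_div], sub_zero] at hshift
    have := hshift.mul_left ((-1 : ℂ) ^ n)
    rw [smul_eq_mul, ← mul_assoc, ← mul_pow] at this
    simpa [add_comm n, risingProd] using this
  · intro m w hw
    obtain ⟨h1, h2⟩ := hball w hw
    rw [norm_div, ← mul_div_assoc]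
    refine div_le_div_of_nonneg_right (norm_binetPoly_le m ?_ ?_) (norm_nonneg _)
    · linarith [(abs_lt.1 h1).2]
    · linarith [abs_sub_abs_le_abs_sub w.re α.re, abs_sub_abs_le_abs_sub w.im α.im]
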